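/- For $n\ge 4$ let $A[D_n]$ be the Artin group of type $D_n$, that is, the group with generators $t_1,\dots,t_n$ and relations $t_it_jt_i=t_jt_it_j$ if $t_i,t_j$ are joined by an edge of the Coxeter graph $D_n$ (the path $t_1,t_2,\dots,t_{n-1}$ together with one further edge joining $t_{n-2}$ and $t_n$), and $t_it_j=t_jt_i$ for all other pairs $i\neq j$. Let $Z(A[D_n])$ be its center and let $A_Z[D_n]=A[D_n]/Z(A[D_n])$. Call an endomorphism of $A_Z[D_n]$ *cyclic* if its image is a cyclic subgroup, and call two endomorphisms $\varphi_1,\varphi_2$ of $A_Z[D_n]$ *conjugate* if there exists $h\in A_Z[D_n]$ such that $\varphi_2(x)=h\,\varphi_1(x)\,h^{-1}$ for all $x\in A_Z[D_n]$. Then, for every $n\ge 4$, there are only finitely many conjugacy classes of cyclic endomorphisms of $A_Z[D_n]$. -/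

import Mathlib

/-- The alternating product `Π(a, b, m) = a * b * a * ⋯` with `m` factors, starting with `a`. -/
def altProd {G : Type*} [Monoid G] (a b : G) : ℕ → G
  | 0 => 1
  | m + 1 => a * altProd b a m

/-- The Artin relators `Π(s, t, m_{s,t}) * Π(t, s, m_{s,t})⁻¹` for `s ≠ t` with `m_{s,t} ≠ ∞`.
In a `CoxeterMatrix` the value `∞` is encoded by the entry `0`. -/
def artinRels {S : Type*} (M : CoxeterMatrix S) : Set (FreeGroup S) :=
  {r | ∃ s t : S, s ≠ t ∧ M s t ≠ 0 ∧
    r = altProd (FreeGroup.of s) (FreeGroup.of t) (M s t) *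
      (altProd (FreeGroup.of t) (FreeGroup.of s) (M s t))⁻¹}

/-- The Artin group of a Coxeter matrix. -/
abbrev ArtinGroup {S : Type*} (M : CoxeterMatrix S) : Type _ :=
  PresentedGroup (artinRels M)

/-- Adjacency in the Coxeter graph `D_n` on the vertices `0, …, n - 1`:
the path `0 - 1 - ⋯ - (n - 2)`, together with the edge from `n - 3` to `n - 1`. -/
def dAdj (n : ℕ) (i j : Fin n) : Prop :=
  ((i : ℕ) + 1 = j ∧ (j : ℕ) + 1 < n) ∨ ((j : ℕ) + 1 = i ∧ (i : ℕ) + 1 < n) ∨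
    ((i : ℕ) + 2 = j ∧ (j : ℕ) + 1 = n) ∨ ((j : ℕ) + 2 = i ∧ (i : ℕ) + 1 = n)

instance (n : ℕ) (i j : Fin n) : Decidable (dAdj n i j) := by
  unfold dAdj; infer_instance

/-- The Coxeter matrix of type `D_n`. (In Mathlib's `CoxeterMatrix.D` the vertices `n - 2` and
`n - 1` are also joined by an edge, so that one is not the Coxeter matrix of type `D_n`.) -/
def coxeterMatrixD (n : ℕ) : CoxeterMatrix (Fin n) where
  M := Matrix.of fun i j => if i = j then 1 else if dAdj n i j then 3 else 2
  isSymm := by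
    ext i j
    have h : dAdj n j i ↔ dAdj n i j := by unfold dAdj; tauto
    simp [Matrix.transpose_apply, h, eq_comm]
  diagonal := by simp
  off_diagonal := by
    intro i j hij
    simp only [Matrix.of_apply, if_neg hij]
    split_ifs <;> decide

/-- The quotient `A[D_n] / Z(A[D_n])` of the Artin group of type `D_n` by its center. -/
abbrev ArtinDModCenter (n : ℕ) : Type :=
  ArtinGroup (coxeterMatrixD n) ⧸ Subgroup.center (ArtinGroup (coxeterMatrixD n))

/-- A homomorphism is cyclic if its image is a cyclic subgroup. -/
def IsCyclicHom {G H : Type*} [Group G] [Group H] (φ : G →* H) : Prop :=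
  IsCyclic φ.range

/-- Conjugacy of homomorphisms `G → H`: `φ₂ = ad_h ∘ φ₁` for some `h ∈ H`, where
`ad_h x = h * x * h⁻¹`. -/
def homConj (G H : Type*) [Group G] [Group H] : Setoid (G →* H) where
  r φ₁ φ₂ := ∃ h : H, φ₂ = (MulAut.conj h).toMonoidHom.comp φ₁
  iseqv :=
    { refl := fun φ => ⟨1, by ext x; simp⟩
      symm := by
        rintro φ₁ φ₂ ⟨h, rfl⟩
        exact ⟨h⁻¹, by ext x; simp [mul_assoc]⟩
      trans := by
        rintro φ₁ φ₂ φ₃ ⟨h, rfl⟩ ⟨k, rfl⟩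
        exact ⟨k * h, by ext x; simp [mul_assoc]⟩ }

-- An abelian image forces all the generators to one common value, because the graph is connected
-- and the braid relation makes adjacent generators agree. Lift this value to `x` in the Artin
-- group. A central positive element `z` dies in the quotient, so `x ^ len z` is central: `x` is
-- periodic modulo the center. It remains to see that, up to conjugacy and the center, only finitely
-- many such `x` exist.
--
-- This is Garside theory. In the Artin monoid of a triangle-free graph, `reduces_of_gen_mul_eq`
-- yields cancellation and least common multiples. A nontrivial central `z` is divisible by every
-- generator, so the monoid embeds in a group, the Artin group consists of fractions over powers of
-- `z`, and divisibility becomes a left-invariant order with joins. If `x ^ N = z ^ p`, conjugating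
-- by the join `v` of suitable `x ^ i * z ^ e` places `x`, up to a power of `z`, between `1` and `z`
-- (`exists_conj_mem_of_pow_eq`). Length is injective on the center, so central powers of `x` do
-- reduce to powers of `z`. Hence `x` is conjugate, modulo the center, to a positive element of
-- length at most `len z`, and words of bounded length are finite in number.
--
-- Type D enters through its graph and through `z`, the square of an explicit product of
-- palindromes.

universe u

/-! ### Artin monoids of triangle-free graphs -/

/-- The defining relations of the simply laced Artin monoid of a graph. -/
inductive BraidRel {S : Type*} (Γ : SimpleGraph S) : FreeMonoid S → FreeMonoid S → Prop
  | comm (s t : S) : ¬ Γ.Adj s t → BraidRel Γ (.of s * .of t) (.of t * .of s)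
  | braid (s t : S) : Γ.Adj s t →
      BraidRel Γ (.of s * .of t * .of s) (.of t * .of s * .of t)

/-- The simply laced Artin monoid of a graph: adjacent generators satisfy the braid relation, and
non-adjacent generators commute. -/
abbrev BraidMonoid {S : Type*} (Γ : SimpleGraph S) : Type _ := PresentedMonoid (BraidRel Γ)

namespace BraidMonoid

variable {S : Type*} {Γ : SimpleGraph S}

/-- The generators of the Artin monoid. -/
def gen (s : S) : BraidMonoid Γ := PresentedMonoid.of _ s

lemma gen_comm {s t : S} (h : ¬ Γ.Adj s t) : (gen s * gen t : BraidMonoid Γ) = gen t * gen s :=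
  PresentedMonoid.mk_eq_mk_of_rel (.comm s t h)

lemma gen_braid {s t : S} (h : Γ.Adj s t) :
    (gen s * gen t * gen s : BraidMonoid Γ) = gen t * gen s * gen t :=
  PresentedMonoid.mk_eq_mk_of_rel (.braid s t h)

lemma gen_comm_assoc {s t : S} (h : ¬ Γ.Adj s t) (x : BraidMonoid Γ) :
    gen s * (gen t * x) = gen t * (gen s * x) := by
  rw [← mul_assoc, gen_comm h, mul_assoc]

lemma gen_braid_assoc {s t : S} (h : Γ.Adj s t) (x : BraidMonoid Γ) :
    gen s * (gen t * (gen s * x)) = gen t * (gen s * (gen t * x)) := by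
  simp only [← mul_assoc, gen_braid h]

/-- A map of the generators that satisfies the relations extends to the Artin monoid. -/
def lift {N : Type*} [Monoid N] (f : S → N)
    (hc : ∀ s t, ¬ Γ.Adj s t → f s * f t = f t * f s)
    (hb : ∀ s t, Γ.Adj s t → f s * f t * f s = f t * f s * f t) : BraidMonoid Γ →* N :=
  PresentedMonoid.lift f (by
    rintro _ _ (⟨s, t, h⟩ | ⟨s, t, h⟩)
    · simpa using hc s t h
    · simpa using hb s t h)

/-- The length homomorphism. -/
def lenHom : BraidMonoid Γ →* Multiplicative ℕ :=
  lift (fun _ => Multiplicative.ofAdd 1) (fun _ _ _ => rfl) (fun _ _ _ => rfl)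

/-- The length of an element. -/
def len (x : BraidMonoid Γ) : ℕ := (lenHom x).toAdd

@[simp] lemma len_one : len (1 : BraidMonoid Γ) = 0 := by simp [len]
@[simp] lemma len_mul (x y : BraidMonoid Γ) : len (x * y) = len x + len y := by simp [len]
@[simp] lemma len_gen (s : S) : len (gen s : BraidMonoid Γ) = 1 := rfl

lemma len_mk (l : FreeMonoid S) : len (PresentedMonoid.mk (BraidRel Γ) l) = l.length := by
  induction l using FreeMonoid.recOn with
  | one => simp
  | of_mul s l ih =>
    rw [map_mul, len_mul, ih, FreeMonoid.length_mul]
    rfl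

lemma eq_one_or_gen_mul (x : BraidMonoid Γ) : x = 1 ∨ ∃ s y, x = gen s * y := by
  obtain ⟨l, rfl⟩ := PresentedMonoid.surjective_mk x
  induction l using FreeMonoid.recOn with
  | one => exact .inl (map_one _)
  | of_mul s l => exact .inr ⟨s, PresentedMonoid.mk _ l, map_mul _ _ _⟩

@[elab_as_elim]
lemma gen_induction {p : BraidMonoid Γ → Prop} (x : BraidMonoid Γ) (one : p 1)
    (mul : ∀ s y, p y → p (gen s * y)) : p x := by
  obtain ⟨l, rfl⟩ := PresentedMonoid.surjective_mk x
  induction l using FreeMonoid.recOn with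
  | one => exact one
  | of_mul s l ih => exact mul s _ ih

lemma hom_ext {N : Type*} [Monoid N] {f g : BraidMonoid Γ →* N}
    (h : ∀ s, f (gen s) = g (gen s)) : f = g :=
  PresentedMonoid.ext _ h

lemma eq_one_of_len_eq_zero {x : BraidMonoid Γ} (h : len x = 0) : x = 1 := by
  obtain h1 | ⟨s, y, rfl⟩ := eq_one_or_gen_mul x
  · exact h1
  · simp at h

lemma exists_gen_of_len_eq_one {x : BraidMonoid Γ} (h : len x = 1) : ∃ s, x = gen s := by
  obtain rfl | ⟨s, y, rfl⟩ := eq_one_or_gen_mul x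
  · simp at h
  · have : y = 1 := eq_one_of_len_eq_zero (by simpa using h)
    exact ⟨s, by rw [this, mul_one]⟩

lemma finite_len_le [Finite S] (n : ℕ) : {x : BraidMonoid Γ | len x ≤ n}.Finite := by
  refine ((List.finite_length_le S n).image
    (fun l => PresentedMonoid.mk (BraidRel Γ) (FreeMonoid.ofList l))).subset ?_
  intro x hx
  obtain ⟨l, rfl⟩ := PresentedMonoid.surjective_mk x
  refine ⟨FreeMonoid.toList l, ?_, rfl⟩
  rw [Set.mem_ofPred_eq, len_mk] at hx
  exact hx

/-- The elements `gen s * u` and `gen t * v` agree through a common right multiple of the least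
common multiple of `gen s` and `gen t`. -/
inductive Reduces : S → BraidMonoid Γ → S → BraidMonoid Γ → Prop
  | same (s : S) (u : BraidMonoid Γ) : Reduces s u s u
  | comm (s t : S) (w : BraidMonoid Γ) : s ≠ t → ¬ Γ.Adj s t →
      Reduces s (gen t * w) t (gen s * w)
  | braid (s t : S) (w : BraidMonoid Γ) : Γ.Adj s t →
      Reduces s (gen t * (gen s * w)) t (gen s * (gen t * w))

lemma Reduces.symm {s t : S} {u v : BraidMonoid Γ} (h : Reduces s u t v) : Reduces t v s u := by
  cases h with
  | same => exact .same _ _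
  | comm _ w h1 h2 => exact .comm _ _ w h1.symm (fun h => h2 h.symm)
  | braid _ w h => exact .braid _ _ w h.symm

lemma Reduces.mul_right {s t : S} {u v : BraidMonoid Γ} (h : Reduces s u t v)
    (x : BraidMonoid Γ) : Reduces s (u * x) t (v * x) := by
  cases h with
  | same => exact .same _ _
  | comm _ w h1 h2 => simpa only [mul_assoc] using .comm s t (w * x) h1 h2
  | braid _ w h => simpa only [mul_assoc] using .braid s t (w * x) h

lemma Reduces.eq_of_same {s : S} {u v : BraidMonoid Γ} (h : Reduces s u s v) : u = v := by
  cases h with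
  | same => rfl
  | comm _ w h1 h2 => exact absurd rfl h1
  | braid _ w h => exact absurd h (Γ.loopless.irrefl s)

lemma Reduces.of_not_adj {s t : S} {u v : BraidMonoid Γ} (h : Reduces s u t v) (hne : s ≠ t)
    (ha : ¬ Γ.Adj s t) : ∃ w, u = gen t * w ∧ v = gen s * w := by
  cases h with
  | same => exact absurd rfl hne
  | comm _ w h1 h2 => exact ⟨w, rfl, rfl⟩
  | braid _ w h => exact absurd h ha

lemma Reduces.of_adj {s t : S} {u v : BraidMonoid Γ} (h : Reduces s u t v) (ha : Γ.Adj s t) :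
    ∃ w, u = gen t * (gen s * w) ∧ v = gen s * (gen t * w) := by
  cases h with
  | same => exact absurd ha (Γ.loopless.irrefl s)
  | comm _ w h1 h2 => exact absurd ha h2
  | braid _ w h => exact ⟨w, rfl, rfl⟩

/-- In a triangle-free graph three vertices span at most two edges, so three generators have an
explicit common multiple. Here `b` is shorter than the products compared, and `ih` peels letters off
it until that multiple appears. -/
lemma Reduces.trans_of_not_adj {k : ℕ}
    (ih : ∀ (s t : S) (u v : BraidMonoid Γ), len u < k → gen s * u = gen t * v → Reduces s u t v)
    {r s t : S} {a b c : BraidMonoid Γ} (hb : len b = k)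
    (h₁ : Reduces r a s b) (h₂ : Reduces s b t c) (hrs : r ≠ s) (hst : s ≠ t)
    (ars : ¬ Γ.Adj r s) : Reduces r a t c := by
  have cancel : ∀ (s : S) (u v : BraidMonoid Γ), len u < k → gen s * u = gen s * v → u = v :=
    fun s u v hu h => (ih s s u v hu h).eq_of_same
  obtain ⟨w, rfl, rfl⟩ := h₁.of_not_adj hrs ars
  simp only [len_mul, len_gen] at hb
  by_cases hrt : r = t
  · subst hrt
    obtain ⟨w', e, rfl⟩ := h₂.of_not_adj hst (fun h => ars h.symm)
    rw [cancel r _ _ (by omega) e]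
    exact .same _ _
  by_cases ast : Γ.Adj s t
  · obtain ⟨w', e, rfl⟩ := h₂.of_adj ast
    by_cases art : Γ.Adj r t
    · obtain ⟨y, rfl, e1⟩ := (ih r t _ _ (by omega) e).of_adj art
      simp only [len_mul, len_gen] at hb
      have ly := congrArg len e1
      simp only [len_mul, len_gen] at ly
      obtain ⟨z, rfl, e2⟩ := (ih s r _ _ (by omega) e1).of_not_adj (Ne.symm hrs)
        (fun h => ars h.symm)
      simp only [len_mul, len_gen] at ly
      obtain ⟨q, rfl, rfl⟩ := (ih t s _ _ (by omega) e2).of_adj ast.symm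
      have := Reduces.braid r t (gen s * (gen t * (gen r * q))) art
      have b1 := gen_comm_assoc ars
      have b2 := gen_braid_assoc ast
      have b3 := gen_braid_assoc art
      clear ih cancel
      convert! this using 1 <;> grind
    · obtain ⟨y, rfl, e1⟩ := (ih r t _ _ (by omega) e).of_not_adj hrt art
      simp only [len_mul, len_gen] at hb
      have ly := congrArg len e1
      simp only [len_mul, len_gen] at ly
      obtain ⟨z, rfl, rfl⟩ := (ih s r _ _ (by omega) e1).of_not_adj (Ne.symm hrs)
        (fun h => ars h.symm)
      have := Reduces.comm r t (gen s * (gen t * z)) hrt art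
      have b1 := gen_comm_assoc ars
      have b2 := gen_braid_assoc ast
      have b3 := gen_comm_assoc art
      clear ih cancel
      convert! this using 1 <;> grind
  · obtain ⟨w', e, rfl⟩ := h₂.of_not_adj hst ast
    have b1 := gen_comm_assoc ars
    have b2 := gen_comm_assoc ast
    by_cases art : Γ.Adj r t
    · obtain ⟨y, rfl, rfl⟩ := (ih r t _ _ (by omega) e).of_adj art
      have := Reduces.braid r t (gen s * y) art
      clear ih cancel
      convert! this using 1 <;> grind
    · obtain ⟨y, rfl, rfl⟩ := (ih r t _ _ (by omega) e).of_not_adj hrt art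
      have := Reduces.comm r t (gen s * y) hrt art
      clear ih cancel
      convert! this using 1 <;> grind

/-- What remains is the path `r - s - t`. Triangle-freeness makes its distinct ends commute. -/
lemma Reduces.trans (hΓ : ∀ a b c, Γ.Adj a b → Γ.Adj b c → ¬ Γ.Adj a c) {k : ℕ}
    (ih : ∀ (s t : S) (u v : BraidMonoid Γ), len u < k → gen s * u = gen t * v → Reduces s u t v)
    {r s t : S} {a b c : BraidMonoid Γ} (hb : len b = k)
    (h₁ : Reduces r a s b) (h₂ : Reduces s b t c) : Reduces r a t c := by
  have cancel : ∀ (s : S) (u v : BraidMonoid Γ), len u < k → gen s * u = gen s * v → u = v :=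
    fun s u v hu h => (ih s s u v hu h).eq_of_same
  by_cases hrs : r = s
  · subst hrs; rwa [h₁.eq_of_same]
  by_cases hst : s = t
  · subst hst; rwa [← h₂.eq_of_same]
  by_cases ars : ¬ Γ.Adj r s
  · exact Reduces.trans_of_not_adj ih hb h₁ h₂ hrs hst ars
  by_cases ast : ¬ Γ.Adj s t
  · exact (Reduces.trans_of_not_adj ih hb h₂.symm h₁.symm (Ne.symm hst) (Ne.symm hrs)
      (fun h => ast h.symm)).symm
  rw [not_not] at ars ast
  obtain ⟨w, rfl, rfl⟩ := h₁.of_adj ars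
  simp only [len_mul, len_gen] at hb
  obtain ⟨w', e, rfl⟩ := h₂.of_adj ast
  by_cases hrt : r = t
  · subst hrt
    have e1 := cancel r _ _ (by simp; omega) e
    rw [cancel s _ _ (by omega) e1]
    exact .same _ _
  · have art := hΓ r s t ars ast
    obtain ⟨y, e1, e2⟩ := (ih r t _ _ (by simp; omega) e).of_not_adj hrt art
    have ly := congrArg len e1
    have lw := congrArg len e2
    simp only [len_mul, len_gen] at ly lw
    obtain ⟨z, rfl, e3⟩ := (ih s t _ _ (by omega) e1).of_adj ast
    obtain ⟨q, rfl, e4⟩ := (ih s r _ _ (by omega) e2).of_adj ars.symm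
    simp only [len_mul, len_gen] at hb ly lw
    have e5 := cancel s _ _ (by simp; omega) (e3.symm.trans e4)
    obtain ⟨p, rfl, rfl⟩ := (ih t r _ _ (by omega) e5).of_not_adj (Ne.symm hrt)
      (fun h => art h.symm)
    have := Reduces.comm r t (gen s * (gen t * (gen r * (gen s * p)))) hrt art
    have b1 := gen_braid_assoc ars
    have b2 := gen_braid_assoc ast
    have b3 := gen_comm_assoc art
    clear ih cancel
    convert! this using 1 <;> grind

/-- Garside's key lemma: outer induction on length, inner induction on a derivation of the equality
of words. Transitivity is the only hard case. -/
lemma reduces_of_gen_mul_eq (hΓ : ∀ a b c, Γ.Adj a b → Γ.Adj b c → ¬ Γ.Adj a c)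
    {s t : S} {u v : BraidMonoid Γ} (h : gen s * u = gen t * v) : Reduces s u t v := by
  induction hk : len u using Nat.strong_induction_on generalizing s t u v with | _ k ih
  replace ih : ∀ (s t : S) (u v : BraidMonoid Γ), len u < k → gen s * u = gen t * v →
    Reduces s u t v := fun s t u v hu h => ih _ hu h rfl
  have main : ∀ x y : FreeMonoid S, ConGen.Rel (BraidRel Γ) x y → x.length = k + 1 →
      ∀ s t (u v : FreeMonoid S), x = .of s * u → y = .of t * v →
        Reduces s (PresentedMonoid.mk (BraidRel Γ) u) t (PresentedMonoid.mk (BraidRel Γ) v) := by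
    have hlen : ∀ x y : FreeMonoid S, ConGen.Rel (BraidRel Γ) x y → x.length = y.length := by
      intro x y h
      rw [← len_mk (Γ := Γ), ← len_mk (Γ := Γ), PresentedMonoid.mk_eq_mk_iff.2 h]
    intro x y hxy
    -- An inequality is needed because the product case passes to a factor, which may be shorter.
    suffices x.length ≤ k + 1 → ∀ s t (u v : FreeMonoid S), x = .of s * u → y = .of t * v →
        Reduces s (PresentedMonoid.mk (BraidRel Γ) u) t (PresentedMonoid.mk (BraidRel Γ) v) from
      fun h => this h.le
    induction hxy with
    | of x y h =>
      intro _ s t u v hx hy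
      obtain ⟨p, q, h⟩ | ⟨p, q, h⟩ := h
      · obtain ⟨rfl, rfl⟩ := List.cons.inj hx
        obtain ⟨rfl, rfl⟩ := List.cons.inj hy
        by_cases hpq : p = q
        · subst hpq; exact .same _ _
        · have := Reduces.comm p q (1 : BraidMonoid Γ) hpq h
          rw [mul_one, mul_one] at this
          exact this
      · obtain ⟨rfl, rfl⟩ := List.cons.inj hx
        obtain ⟨rfl, rfl⟩ := List.cons.inj hy
        have := Reduces.braid p q (1 : BraidMonoid Γ) h
        rw [mul_one, mul_one] at this
        exact this
    | refl x =>
      rintro _ s t u v rfl hy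
      obtain ⟨rfl, rfl⟩ := List.cons.inj hy
      exact .same _ _
    | symm h ih' =>
      intro hl s t u v hx hy
      exact (ih' (by rw [hlen _ _ h]; exact hl) t s v u hy hx).symm
    | @trans x y z h1 h2 ih1 ih2 =>
      rintro hl s t u v rfl rfl
      have e := hlen _ _ h1
      rcases y with _ | ⟨r, w⟩
      · exact absurd e (Nat.succ_ne_zero _)
      refine Reduces.trans hΓ (fun s t u v hu => ih s t u v (lt_of_lt_of_le hu ?_)) rfl
        (ih1 hl s r u w rfl rfl) (ih2 (by rwa [← e]) r t w v rfl rfl)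
      refine le_of_eq_of_le (len_mk _) ?_
      rw [e] at hl
      exact Nat.le_of_succ_le_succ hl
    | @mul x x' y y' h1 h2 ih1 ih2 =>
      intro hl s t u v hx hy
      have e := hlen _ _ h1
      rw [FreeMonoid.length_mul] at hl
      rcases x with _ | ⟨p, x⟩
      · rcases x' with _ | ⟨p', x'⟩
        · exact ih2 (by omega) s t u v hx hy
        · exact absurd e.symm (Nat.succ_ne_zero _)
      · rcases x' with _ | ⟨p', x'⟩
        · exact absurd e (Nat.succ_ne_zero _)
        · obtain ⟨rfl, rfl⟩ := List.cons.inj hx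
          obtain ⟨rfl, rfl⟩ := List.cons.inj hy
          have := (ih1 (by omega) p p' x x' rfl rfl).mul_right (PresentedMonoid.mk _ y)
          convert! this using 1
          rw [PresentedMonoid.mk_eq_mk_iff.2 h2]
          exact map_mul _ _ _
  obtain ⟨u, rfl⟩ := PresentedMonoid.surjective_mk u
  obtain ⟨v, rfl⟩ := PresentedMonoid.surjective_mk v
  rw [len_mk] at hk
  refine main (.of s * u) (.of t * v) (PresentedMonoid.mk_eq_mk_iff.1 ?_) ?_ s t u v rfl rfl
  · rw [map_mul, map_mul]
    exact h
  · rw [FreeMonoid.length_mul, hk, FreeMonoid.length_of, add_comm]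

lemma left_cancel (hΓ : ∀ a b c, Γ.Adj a b → Γ.Adj b c → ¬ Γ.Adj a c)
    (a : BraidMonoid Γ) {u v : BraidMonoid Γ} (h : a * u = a * v) : u = v := by
  induction a using gen_induction with
  | one => simpa using h
  | mul s y ih =>
    rw [mul_assoc, mul_assoc] at h
    exact ih (reduces_of_gen_mul_eq hΓ h).eq_of_same

/-- The anti-automorphism that reverses words. -/
def revHom : BraidMonoid Γ →* (BraidMonoid Γ)ᵐᵒᵖ :=
  lift (fun s => .op (gen s))
    (fun s t h => by rw [← MulOpposite.op_mul, ← MulOpposite.op_mul, gen_comm h])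
    (fun s t h => by
      simp only [← MulOpposite.op_mul, ← mul_assoc, gen_braid h])

/-- The reversal of an element. -/
def rev (x : BraidMonoid Γ) : BraidMonoid Γ := (revHom x).unop

lemma rev_mul (x y : BraidMonoid Γ) : rev (x * y) = rev y * rev x := by simp [rev]

lemma rev_gen (s : S) : rev (gen s : BraidMonoid Γ) = gen s := rfl

lemma rev_rev (x : BraidMonoid Γ) : rev (rev x) = x := by
  induction x using gen_induction with
  | one => simp [rev]
  | mul s y ih => rw [rev_mul, rev_mul, ih, rev_gen, rev_gen]

lemma right_cancel (hΓ : ∀ a b c, Γ.Adj a b → Γ.Adj b c → ¬ Γ.Adj a c)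
    (a : BraidMonoid Γ) {u v : BraidMonoid Γ} (h : u * a = v * a) : u = v := by
  have := congrArg rev h
  rw [rev_mul, rev_mul] at this
  rw [← rev_rev u, left_cancel hΓ _ this, rev_rev]

lemma mul_dvd_mul_left_iff (hΓ : ∀ a b c, Γ.Adj a b → Γ.Adj b c → ¬ Γ.Adj a c)
    (a : BraidMonoid Γ) {u v : BraidMonoid Γ} : a * u ∣ a * v ↔ u ∣ v := by
  refine ⟨?_, fun h => mul_dvd_mul_left a h⟩
  rintro ⟨c, hc⟩
  exact ⟨c, left_cancel hΓ a (by rw [hc, mul_assoc])⟩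

/-- The element `l` is a least common right multiple of `a` and `b`. -/
def IsRightLcm (a b l : BraidMonoid Γ) : Prop := ∀ w, l ∣ w ↔ a ∣ w ∧ b ∣ w

lemma IsRightLcm.mul_left (hΓ : ∀ a b c, Γ.Adj a b → Γ.Adj b c → ¬ Γ.Adj a c)
    {a b l : BraidMonoid Γ} (h : IsRightLcm a b l) (c : BraidMonoid Γ) :
    IsRightLcm (c * a) (c * b) (c * l) := by
  intro w
  constructor
  · intro hw
    exact ⟨(mul_dvd_mul_left c ((h l).1 dvd_rfl).1).trans hw,
      (mul_dvd_mul_left c ((h l).1 dvd_rfl).2).trans hw⟩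
  · rintro ⟨ha, hb⟩
    obtain ⟨w, rfl⟩ := (dvd_mul_right c a).trans ha
    rw [mul_dvd_mul_left_iff hΓ] at ha hb ⊢
    exact (h w).2 ⟨ha, hb⟩

/-- Treats the three cases uniformly: the pair `s`, `t` alone decides which case occurs, so `gen s *
p` serves every common multiple at once. -/
lemma Reduces.exists_lcm {s t : S} {u v : BraidMonoid Γ} (h : Reduces s u t v) :
    ∃ p q w : BraidMonoid Γ, gen s * p = gen t * q ∧ u = p * w ∧ v = q * w ∧
      ∀ u' v', Reduces s u' t v' → gen s * p ∣ gen s * u' := by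
  cases h with
  | same => exact ⟨1, 1, u, rfl, by simp, by simp, fun u' v' _ => by simp⟩
  | comm _ w h1 h2 =>
    refine ⟨gen t, gen s, w, gen_comm h2, rfl, rfl, fun u' v' h => ?_⟩
    obtain ⟨x, rfl, -⟩ := h.of_not_adj h1 h2
    exact ⟨x, by rw [mul_assoc]⟩
  | braid _ w h1 =>
    refine ⟨gen t * gen s, gen s * gen t, w, ?_, ?_, ?_, fun u' v' h => ?_⟩
    · rw [← mul_assoc, ← mul_assoc, gen_braid h1]
    · rw [mul_assoc]
    · rw [mul_assoc]
    · obtain ⟨x, rfl, -⟩ := h.of_adj h1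
      exact ⟨x, by simp only [mul_assoc]⟩

/-- Two elements with a common right multiple have a least common right multiple. -/
theorem exists_isRightLcm (hΓ : ∀ a b c, Γ.Adj a b → Γ.Adj b c → ¬ Γ.Adj a c)
    {a b m : BraidMonoid Γ} (ha : a ∣ m) (hb : b ∣ m) : ∃ l, IsRightLcm a b l := by
  induction hk : len m using Nat.strong_induction_on generalizing a b m with | _ k ih
  obtain rfl | ⟨s, a, rfl⟩ := eq_one_or_gen_mul a
  · exact ⟨b, fun w => by simp⟩
  obtain rfl | ⟨t, b, rfl⟩ := eq_one_or_gen_mul b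
  · exact ⟨gen s * a, fun w => by simp⟩
  obtain ⟨m₁, rfl⟩ := (dvd_mul_right _ a).trans ha
  obtain ⟨m₂, hm⟩ := (dvd_mul_right _ b).trans hb
  obtain ⟨p, q, m', hpq, rfl, rfl, hlcm⟩ := (reduces_of_gen_mul_eq hΓ hm).exists_lcm
  have lm := congrArg len hm
  have lpq := congrArg len hpq
  simp only [len_mul, len_gen] at hk lm lpq
  rw [mul_dvd_mul_left_iff hΓ] at ha
  rw [hm, mul_dvd_mul_left_iff hΓ] at hb
  -- Three joins of divisors of shorter elements are glued: `a` with `p`, `b` with `q`, then the two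
  -- complements over `gen s * p`.
  obtain ⟨A, hA⟩ := ih _ (by simp; omega) ha (dvd_mul_right p m') rfl
  obtain ⟨B, hB⟩ := ih _ (by simp; omega) hb (dvd_mul_right q m') rfl
  have hAm := (hA _).2 ⟨ha, dvd_mul_right p m'⟩
  have hBm := (hB _).2 ⟨hb, dvd_mul_right q m'⟩
  obtain ⟨A', rfl⟩ := ((hA A).1 dvd_rfl).2
  obtain ⟨B', rfl⟩ := ((hB B).1 dvd_rfl).2
  rw [mul_dvd_mul_left_iff hΓ] at hAm hBm
  obtain ⟨L, hL⟩ := ih _ (by omega) hAm hBm rfl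
  refine ⟨gen s * p * L, fun w => ?_⟩
  rw [hL.mul_left hΓ (gen s * p) w]
  have h1 := hA.mul_left hΓ (gen s) w
  have h2 := hB.mul_left hΓ (gen t) w
  rw [← mul_assoc] at h1 h2
  rw [← hpq] at h2
  rw [h1, h2]
  refine ⟨fun h => ⟨h.1.1, h.2.1⟩, fun h => ?_⟩
  obtain ⟨u', rfl⟩ := (dvd_mul_right _ a).trans h.1
  obtain ⟨v', hv'⟩ := (dvd_mul_right _ b).trans h.2
  have := hlcm u' v' (reduces_of_gen_mul_eq hΓ hv')
  exact ⟨⟨h.1, this⟩, h.2, this⟩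

/-- An element is quasi-central if conjugation by it preserves the set of generators. -/
def IsQuasiCentral (q : BraidMonoid Γ) : Prop := ∀ s, ∃ t, gen s * q = q * gen t

/-- Divisibility spreads along edges: if `gen s` divides `q`, then both `gen s` and `gen t` divide
`gen t * q`, hence so does their braid word, and `q` begins with `gen s * gen t`. Moving `gen s`
through `q` and cancelling leaves `gen t` in front. -/
lemma IsQuasiCentral.gen_dvd (hΓ : ∀ a b c, Γ.Adj a b → Γ.Adj b c → ¬ Γ.Adj a c)
    (hconn : Γ.Preconnected) {q : BraidMonoid Γ} (hq : IsQuasiCentral q) (h1 : q ≠ 1) (s : S) :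
    gen s ∣ q := by
  have step : ∀ s t, Γ.Adj s t → gen s ∣ q → gen t ∣ q := by
    rintro s t hst ⟨y, hy⟩
    obtain ⟨t', ht⟩ := hq t
    obtain ⟨s', hs⟩ := hq s
    have e : gen t * q = gen s * (y * gen t') := by rw [ht, hy, mul_assoc]
    obtain ⟨w, hw, -⟩ := (reduces_of_gen_mul_eq hΓ e).of_adj hst.symm
    have : gen s * q = gen s * (gen t * (w * gen s')) := by
      rw [hs]; nth_rw 1 [hw]; simp only [mul_assoc]
    exact ⟨w * gen s', left_cancel hΓ _ this⟩
  obtain h | ⟨s₀, y, hy⟩ := eq_one_or_gen_mul q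
  · exact absurd h h1
  obtain ⟨p⟩ := hconn s₀ s
  have h0 : gen s₀ ∣ q := ⟨y, hy⟩
  clear hy
  induction p with
  | nil => exact h0
  | cons hadj _ ih => exact ih (step _ _ hadj h0)

/-- Moving generators through `q` permutes the finite set of generators, which turns left divisors
into right divisors. -/
lemma IsQuasiCentral.exists_mul_gen [Finite S]
    (hΓ : ∀ a b c, Γ.Adj a b → Γ.Adj b c → ¬ Γ.Adj a c)
    (hconn : Γ.Preconnected) {q : BraidMonoid Γ} (hq : IsQuasiCentral q) (h1 : q ≠ 1) (t : S) :
    ∃ y, q = y * gen t := by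
  choose π hπ using id hq
  have gen_inj : Function.Injective (gen : S → BraidMonoid Γ) := by
    intro s t h
    have h := reduces_of_gen_mul_eq hΓ (u := 1) (v := 1) (by simpa using h)
    by_contra hst
    by_cases ha : Γ.Adj s t
    · obtain ⟨w, hw, -⟩ := h.of_adj ha
      exact absurd (congrArg len hw) (by simp; omega)
    · obtain ⟨w, hw, -⟩ := h.of_not_adj hst ha
      exact absurd (congrArg len hw) (by simp; omega)
  have hinj : Function.Injective π := fun s s' h => gen_inj <|
    right_cancel hΓ q (by rw [hπ, hπ, h])
  obtain ⟨s, rfl⟩ := (Finite.injective_iff_surjective.1 hinj) t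
  obtain ⟨y, hy⟩ := hq.gen_dvd hΓ hconn h1 s
  refine ⟨y, left_cancel hΓ (gen s) ?_⟩
  rw [hπ, ← mul_assoc, ← hy]

lemma exists_dvd_pow {z : BraidMonoid Γ} (hz : ∀ x, z * x = x * z) (hg : ∀ s, gen s ∣ z)
    (a : BraidMonoid Γ) : ∃ k : ℕ, a ∣ z ^ k := by
  induction a using gen_induction with
  | one => exact ⟨0, one_dvd _⟩
  | mul s y ih =>
    obtain ⟨k, b, hb⟩ := ih
    obtain ⟨c, hc⟩ := hg s
    have hzk : Commute (z ^ k) c := (show Commute z c from hz c).pow_left k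
    refine ⟨k + 1, b * c, ?_⟩
    rw [mul_assoc, ← mul_assoc y, ← hb, hzk.eq, ← mul_assoc, ← hc, pow_succ']

/-- The Artin monoid embeds in a group as soon as some central element is a multiple of all the
generators. -/
theorem exists_injective_hom_group {S : Type u} {Γ : SimpleGraph S}
    (hΓ : ∀ a b c, Γ.Adj a b → Γ.Adj b c → ¬ Γ.Adj a c)
    {z : BraidMonoid Γ} (hz : ∀ x, z * x = x * z) (hg : ∀ s, gen s ∣ z) :
    ∃ (U : Type u) (_ : Group U) (j : BraidMonoid Γ →* U), Function.Injective j := by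
  have hore : ∀ (r : BraidMonoid Γ) (s : (⊤ : Submonoid (BraidMonoid Γ))),
      ∃ p : BraidMonoid Γ × (⊤ : Submonoid (BraidMonoid Γ)), p.2 * r = p.1 * s := by
    intro r s
    -- A power of the central `z` is a multiple of `s`, and it serves as the new denominator.
    obtain ⟨k, b, hb⟩ := exists_dvd_pow hz hg (s : BraidMonoid Γ)
    have hc : ∀ x, z ^ k * x = x * z ^ k := fun x => ((show Commute z x from hz x).pow_left k).eq
    refine ⟨(r * b, ⟨z ^ k, trivial⟩), ?_⟩
    have : b * s = z ^ k := left_cancel hΓ (s : BraidMonoid Γ) (by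
      rw [← mul_assoc, ← hb, hc])
    simp only [mul_assoc, this, hc]
  choose f hf using hore
  let _ : OreLocalization.OreSet (⊤ : Submonoid (BraidMonoid Γ)) :=
    { ore_right_cancel := fun r₁ r₂ s h => ⟨s, by rw [right_cancel hΓ (s : BraidMonoid Γ) h]⟩
      oreNum := fun r s => (f r s).1
      oreDenom := fun r s => (f r s).2
      ore_eq := hf }
  refine ⟨(OreLocalization (⊤ : Submonoid (BraidMonoid Γ)) (BraidMonoid Γ))ˣ, inferInstance,
    IsUnit.liftRight OreLocalization.numeratorHom
      (fun x => OreLocalization.numerator_isUnit (S := ⊤) ⟨x, trivial⟩), fun x y hxy => ?_⟩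
  have h := congrArg Units.val hxy
  rw [IsUnit.coe_liftRight, IsUnit.coe_liftRight, OreLocalization.numeratorHom_apply,
    OreLocalization.numeratorHom_apply, OreLocalization.oreDiv_eq_iff] at h
  obtain ⟨u, v, h1, h2⟩ := h
  have huv : (u : BraidMonoid Γ) = v := by simpa using h2
  rw [← huv] at h1
  exact (left_cancel hΓ (u : BraidMonoid Γ) h1).symm

end BraidMonoid

/-! ### Periodic elements of groups with joins -/

section Joins

variable {G : Type*} [Group G] {P : Submonoid G}

/-- The element `v` is a join of the family `a` for the left-invariant order with positive
cone `P`. -/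
def IsJoin {ι : Type*} (P : Submonoid G) (a : ι → G) (v : G) : Prop :=
  ∀ w, v⁻¹ * w ∈ P ↔ ∀ i, (a i)⁻¹ * w ∈ P

lemma exists_isJoin_of_binary (hjoin : ∀ a b : G, ∃ v, ∀ w, v⁻¹ * w ∈ P ↔
    a⁻¹ * w ∈ P ∧ b⁻¹ * w ∈ P) (n : ℕ) (a : Fin (n + 1) → G) : ∃ v, IsJoin P a v := by
  induction n with
  | zero => exact ⟨a 0, fun w => ⟨fun h i => by rwa [Fin.fin_one_eq_zero i], fun h => h 0⟩⟩
  | succ n ih =>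
    obtain ⟨u, hu⟩ := ih (fun i => a i.castSucc)
    obtain ⟨v, hv⟩ := hjoin u (a (Fin.last _))
    refine ⟨v, fun w => ?_⟩
    rw [hv, hu w]
    exact (Fin.forall_fin_succ' (P := fun i => (a i)⁻¹ * w ∈ P)).symm

/-- If `x` has a power in the group generated by the positive central element `z`, then some
conjugate of `x` is the product of a power of `z` and an element between `1` and `z`. -/
theorem exists_conj_mem_of_pow_eq (hjoin : ∀ a b : G, ∃ v, ∀ w, v⁻¹ * w ∈ P ↔
    a⁻¹ * w ∈ P ∧ b⁻¹ * w ∈ P) {z : G} (hzP : z ∈ P) (hz : ∀ x, Commute z x)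
    {x : G} {N : ℕ} (hN : 0 < N) {p : ℤ} (hx : x ^ N = z ^ p) :
    ∃ (v : G) (r : ℤ), z ^ (-r) * (v⁻¹ * x * v) ∈ P ∧ z * (z ^ (-r) * (v⁻¹ * x * v))⁻¹ ∈ P := by
  have hzk : ∀ (k : ℤ) (y : G), y * z ^ k = z ^ k * y := fun k y => ((hz y).zpow_left k).eq.symm
  have hzpos : ∀ k : ℤ, 0 ≤ k → z ^ k ∈ P := by
    intro k hk
    lift k to ℕ using hk
    rw [zpow_natCast]
    exact P.pow_mem hzP k
  have hN0 : (0 : ℤ) < N := by exact_mod_cast hN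
  -- Heuristically `x` is `z` to the power `p / N`; the rounded exponent brings `x ^ i` back near
  -- `1`. The family has period `N`, so its join is a finite one.
  set a : ℤ → G := fun i => x ^ i * z ^ ((-(p * i)) / (N : ℤ)) with ha
  have hper : ∀ i j : ℤ, a (i + N * j) = a i := by
    intro i j
    have e1 : x ^ (i + N * j) = x ^ i * z ^ (p * j) := by
      rw [zpow_add, zpow_mul, zpow_natCast, hx, zpow_mul]
    have e2 : (-(p * (i + N * j))) / (N : ℤ) = -(p * i) / (N : ℤ) + -(p * j) := by
      rw [← Int.add_mul_ediv_left _ _ hN0.ne']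
      congr 1; ring
    simp only [ha]
    rw [e1, e2, mul_assoc, ← zpow_add]
    congr 2; ring
  have hle : ∀ (i k : ℤ), k ≤ (-(p * i)) / (N : ℤ) → (x ^ i * z ^ k)⁻¹ * a i ∈ P := by
    intro i k hk
    have : (x ^ i * z ^ k)⁻¹ * a i = z ^ ((-(p * i)) / (N : ℤ) - k) := by
      simp only [ha]
      generalize (-(p * i)) / (N : ℤ) = e
      rw [sub_eq_add_neg, zpow_add, ← hzk]
      group
    rw [this]
    exact hzpos _ (by omega)
  obtain ⟨n, rfl⟩ : ∃ n, N = n + 1 := ⟨N - 1, by omega⟩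
  obtain ⟨v, hv⟩ : ∃ v, IsJoin P a v := by
    obtain ⟨v, hv⟩ := exists_isJoin_of_binary hjoin n (fun i => a (i : ℕ))
    refine ⟨v, fun w => ?_⟩
    rw [hv w]
    refine ⟨fun h i => ?_, fun h i => h _⟩
    have h1 := Int.emod_nonneg i hN0.ne'
    have h2 := Int.emod_lt_of_pos i hN0
    have h3 := h ⟨(i % ((n + 1 : ℕ) : ℤ)).toNat, by omega⟩
    simp only [Int.toNat_of_nonneg h1] at h3
    rwa [← hper _ (i / ((n + 1 : ℕ) : ℤ)), Int.emod_add_mul_ediv] at h3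
  have hav : ∀ i, (a i)⁻¹ * v ∈ P := (hv v).1 (by simp)
  have hle' : ∀ (i k : ℤ), k ≤ (-(p * i)) / ((n + 1 : ℕ) : ℤ) → (x ^ i * z ^ k)⁻¹ * v ∈ P := by
    intro i k hk
    have := P.mul_mem (hle i k hk) (hav i)
    rwa [mul_assoc, mul_inv_cancel_left] at this
  -- With `r` the floor of `p / N`, superadditivity of the floor gives `v ≤ x * v * z ^ (-r) ≤ v *
  -- z`.
  refine ⟨v, p / ((n + 1 : ℕ) : ℤ), ?_, ?_⟩
  · set r := p / ((n + 1 : ℕ) : ℤ) with hr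
    have key : v⁻¹ * (x * v * z ^ (-r)) ∈ P := by
      rw [hv]
      intro i
      have h1 := hle' (i - 1) ((-(p * i)) / ((n + 1 : ℕ) : ℤ) + r) (by
        have e : -(p * (i - 1)) = -(p * i) + p := by ring
        rw [e, hr]
        exact Int.ediv_add_ediv_le_add_ediv hN0)
      convert! h1 using 1
      simp only [ha]
      generalize (-(p * i)) / ((n + 1 : ℕ) : ℤ) = e
      rw [← mul_assoc, hzk]
      group
    convert! key using 1
    rw [← hzk]
    group
  · set r := p / ((n + 1 : ℕ) : ℤ) with hr
    have key : v⁻¹ * (x⁻¹ * v * z ^ (r + 1)) ∈ P := by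
      rw [hv]
      intro i
      have h1 := hle' (i + 1) ((-(p * i)) / ((n + 1 : ℕ) : ℤ) - (r + 1)) (by
        have e : -(p * (i + 1)) = -(p * i) + -p := by ring
        have h2 : -(r + 1) ≤ (-p) / ((n + 1 : ℕ) : ℤ) := by
          rw [Int.le_ediv_iff_mul_le hN0]
          have := Int.lt_ediv_add_one_mul_self p hN0
          linarith
        rw [e]
        have := Int.ediv_add_ediv_le_add_ediv (x := -(p * i)) (y := -p) hN0
        omega)
      convert! h1 using 1
      simp only [ha]
      generalize (-(p * i)) / ((n + 1 : ℕ) : ℤ) = e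
      rw [← mul_assoc, hzk]
      group
    convert! key using 1
    rw [mul_inv_rev, zpow_neg, inv_inv, hzk, ← mul_assoc, ← zpow_one_add, add_comm 1 r, ← hzk]
    simp only [mul_inv_rev, inv_inv, mul_assoc]

end Joins

/-! ### Groups of fractions of Artin monoids -/

section Fractions

open BraidMonoid

variable {S : Type*} {Γ : SimpleGraph S} {G : Type*} [Group G]

/-- The group `G` is the group of fractions of the Artin monoid of `Γ` through `j`, with
denominators the powers of the central element `z`, and `ℓ` extends the length. -/
structure IsFractionGroup (z : BraidMonoid Γ) (j : BraidMonoid Γ →* G)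
    (ℓ : G →* Multiplicative ℤ) : Prop where
  triangleFree : ∀ a b c, Γ.Adj a b → Γ.Adj b c → ¬ Γ.Adj a c
  preconnected : Γ.Preconnected
  central : ∀ x, z * x = x * z
  ne_one : z ≠ 1
  injective : Function.Injective j
  exists_mul_pow : ∀ g, ∃ (k : ℕ) (a : BraidMonoid Γ), g * j z ^ k = j a
  map_gen : ∀ s, ℓ (j (gen s)) = Multiplicative.ofAdd 1

namespace IsFractionGroup

variable {z : BraidMonoid Γ} {j : BraidMonoid Γ →* G} {ℓ : G →* Multiplicative ℤ}

lemma gen_dvd (h : IsFractionGroup z j ℓ) (s : S) : gen s ∣ z :=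
  IsQuasiCentral.gen_dvd h.triangleFree h.preconnected (fun s => ⟨s, (h.central _).symm⟩) h.ne_one s

lemma length_map (h : IsFractionGroup z j ℓ) (a : BraidMonoid Γ) :
    ℓ (j a) = Multiplicative.ofAdd (len a : ℤ) := by
  induction a using gen_induction with
  | one => simp
  | mul s y ih =>
    rw [map_mul, map_mul, ih, h.map_gen, ← ofAdd_add, len_mul, len_gen]
    push_cast; rfl

lemma commute (h : IsFractionGroup z j ℓ) (g : G) : Commute (j z) g := by
  obtain ⟨k, a, hk⟩ := h.exists_mul_pow g
  have h1 : Commute (j z) (j a) := by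
    rw [Commute, SemiconjBy, ← map_mul, h.central, map_mul]
  rw [← hk] at h1
  have h2 : Commute (j z) ((j z ^ k)⁻¹) := ((Commute.refl (j z)).pow_right k).inv_right
  simpa using h1.mul_right h2

/-- Clearing denominators by a common central `z ^ n` reduces joins to least common multiples in the
monoid. -/
lemma exists_join (h : IsFractionGroup z j ℓ) (a b : G) : ∃ v, ∀ w, v⁻¹ * w ∈ MonoidHom.mrange j ↔
    a⁻¹ * w ∈ MonoidHom.mrange j ∧ b⁻¹ * w ∈ MonoidHom.mrange j := by
  obtain ⟨k, a', ha⟩ := h.exists_mul_pow a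
  obtain ⟨m, b', hb⟩ := h.exists_mul_pow b
  have hc : ∀ (n : ℕ) (g : G), g * j z ^ n = j z ^ n * g := fun n g =>
    ((h.commute g).pow_left n).eq.symm
  have hc' : ∀ (n : ℕ) (g : BraidMonoid Γ), g * z ^ n = z ^ n * g := fun n g =>
    ((show Commute z g from h.central g).pow_left n).eq.symm
  have ha : j (a' * z ^ m) = a * j z ^ (k + m) := by
    rw [map_mul, map_pow, ← ha, pow_add, mul_assoc]
  have hb : j (b' * z ^ k) = b * j z ^ (k + m) := by
    rw [map_mul, map_pow, ← hb, add_comm, pow_add, mul_assoc]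
  generalize a' * z ^ m = A at ha
  generalize b' * z ^ k = B at hb
  generalize k + m = n at ha hb
  obtain ⟨l, hl⟩ : ∃ l, IsRightLcm A B l := by
    obtain ⟨p, x, hx⟩ := exists_dvd_pow h.central h.gen_dvd A
    obtain ⟨q, y, hy⟩ := exists_dvd_pow h.central h.gen_dvd B
    refine exists_isRightLcm h.triangleFree (m := z ^ p * z ^ q) ⟨x * z ^ q, ?_⟩ ⟨y * z ^ p, ?_⟩
    · rw [hx, mul_assoc]
    · rw [← hc', hy, mul_assoc]
  have key : ∀ (c : BraidMonoid Γ) (w : G), (j c * (j z ^ n)⁻¹)⁻¹ * w ∈ MonoidHom.mrange j ↔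
      ∃ u, w * j z ^ n = j u ∧ c ∣ u := by
    intro c w
    have e : (j c * (j z ^ n)⁻¹)⁻¹ * w = (j c)⁻¹ * (w * j z ^ n) := by
      rw [← mul_assoc, hc]; group
    rw [e, MonoidHom.mem_mrange]
    constructor
    · rintro ⟨x, hx⟩
      exact ⟨c * x, by rw [map_mul, hx, mul_inv_cancel_left], dvd_mul_right _ _⟩
    · rintro ⟨u, hu, x, rfl⟩
      exact ⟨x, by rw [hu, map_mul, inv_mul_cancel_left]⟩
  refine ⟨j l * (j z ^ n)⁻¹, fun w => ?_⟩
  rw [show a = j A * (j z ^ n)⁻¹ by rw [ha, mul_inv_cancel_right],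
    show b = j B * (j z ^ n)⁻¹ by rw [hb, mul_inv_cancel_right], key, key, key]
  constructor
  · rintro ⟨u, hu, hlu⟩
    exact ⟨⟨u, hu, ((hl u).1 hlu).1⟩, u, hu, ((hl u).1 hlu).2⟩
  · rintro ⟨⟨u, hu, hAu⟩, u', hu', hBu⟩
    obtain rfl := h.injective (hu.symm.trans hu')
    exact ⟨u, hu, (hl u).2 ⟨hAu, hBu⟩⟩

/-- A central element is positive, or its inverse is. -/
lemma mem_or_inv_mem [Finite S] (h : IsFractionGroup z j ℓ) {ζ : G} (hζ : ∀ g, ζ * g = g * ζ) :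
    ζ ∈ MonoidHom.mrange j ∨ ζ⁻¹ ∈ MonoidHom.mrange j := by
  -- Here `p` and `q` represent `d` and `ζ⁻¹ * d`. Both are quasi-central, since `gen s * d` is
  -- still above `1` and `ζ`. Were both nontrivial, they would end in a common generator, which
  -- could be removed from `d`, against minimality.
  obtain ⟨d, hd⟩ := h.exists_join 1 ζ
  have hdd := (hd d).1 (by simp [one_mem])
  rw [inv_one, one_mul] at hdd
  obtain ⟨⟨p, hp⟩, q, hq⟩ := hdd
  have hζ' : ∀ g, ζ⁻¹ * g = g * ζ⁻¹ := fun g =>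
    ((show Commute ζ g from hζ g).inv_left).eq
  have hquasi : ∀ s, ∃ t, j (gen s) * d = d * j (gen t) := by
    intro s
    obtain ⟨y, hy⟩ : d⁻¹ * (j (gen s) * d) ∈ MonoidHom.mrange j := by
      rw [hd]
      constructor
      · exact ⟨gen s * p, by rw [map_mul, hp, inv_one, one_mul]⟩
      · refine ⟨gen s * q, ?_⟩
        rw [map_mul, hq, ← mul_assoc, ← hζ', mul_assoc]
    have hlen : len y = 1 := by
      have := congrArg ℓ hy
      rw [h.length_map, map_mul, map_mul, map_inv, mul_comm (ℓ (j (gen s))),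
        inv_mul_cancel_left, h.map_gen] at this
      have : (len y : ℤ) = 1 := Multiplicative.ofAdd.injective this
      exact_mod_cast this
    obtain ⟨t, rfl⟩ := exists_gen_of_len_eq_one hlen
    exact ⟨t, by rw [hy, mul_inv_cancel_left]⟩
  have hpq : IsQuasiCentral p := by
    intro s
    obtain ⟨t, ht⟩ := hquasi s
    exact ⟨t, h.injective (by rw [map_mul, map_mul, hp, ht])⟩
  have hqq : IsQuasiCentral q := by
    intro s
    obtain ⟨t, ht⟩ := hquasi s
    refine ⟨t, h.injective ?_⟩
    rw [map_mul, map_mul, hq, mul_assoc, ← ht, ← mul_assoc, ← hζ', mul_assoc]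
  by_cases hp1 : p = 1
  · right
    rw [hp1, map_one] at hp
    exact ⟨q, by rw [hq, ← hp, mul_one]⟩
  by_cases hq1 : q = 1
  · left
    rw [hq1, map_one, eq_inv_mul_iff_mul_eq, mul_one] at hq
    exact ⟨p, by rw [hp, hq]⟩
  obtain h0 | ⟨s, -⟩ := eq_one_or_gen_mul p
  · exact absurd h0 hp1
  obtain ⟨p', rfl⟩ := hpq.exists_mul_gen h.triangleFree h.preconnected hp1 s
  obtain ⟨q', rfl⟩ := hqq.exists_mul_gen h.triangleFree h.preconnected hq1 s
  rw [map_mul] at hp hq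
  have hs : d⁻¹ * (d * (j (gen s))⁻¹) ∈ MonoidHom.mrange j := by
    rw [hd]
    refine ⟨⟨p', ?_⟩, q', ?_⟩
    · rw [← hp]; group
    · rw [← mul_assoc, ← hq]; group
  rw [inv_mul_cancel_left] at hs
  obtain ⟨y, hy⟩ := hs
  have := congrArg ℓ hy
  rw [h.length_map, map_inv, h.map_gen, ← ofAdd_neg] at this
  have := Multiplicative.ofAdd.injective this
  omega

/-- The length is injective on the center. -/
lemma eq_one_of_length_eq_one [Finite S] (h : IsFractionGroup z j ℓ) {ζ : G}
    (hζ : ∀ g, ζ * g = g * ζ) (hl : ℓ ζ = 1) : ζ = 1 := by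
  have key : ∀ a, ℓ (j a) = 1 → j a = 1 := by
    intro a ha
    rw [h.length_map] at ha
    have : (len a : ℤ) = 0 := Multiplicative.ofAdd.injective ha
    rw [eq_one_of_len_eq_zero (x := a) (by exact_mod_cast this), map_one]
  obtain ⟨a, ha⟩ | ⟨a, ha⟩ := h.mem_or_inv_mem hζ
  · rw [← ha]; exact key a (by rw [ha, hl])
  · rw [← inv_eq_one, ← ha]; exact key a (by rw [ha, map_inv, hl, inv_one])

/-- Every element with a central power is conjugate, modulo the center, to a positive element of
length at most that of `z`. -/
theorem exists_conj_of_pow_central [Finite S] (h : IsFractionGroup z j ℓ) {x : G} {N : ℕ}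
    (hN : 0 < N) (hx : x ^ N ∈ Subgroup.center G) :
    ∃ (v : G) (a : BraidMonoid Γ) (ζ : G), ζ ∈ Subgroup.center G ∧ len a ≤ len z ∧
      v⁻¹ * x * v = ζ * j a := by
  have hz0 : 0 < len z := Nat.pos_of_ne_zero fun h0 => h.ne_one (eq_one_of_len_eq_zero h0)
  have hzc : j z ∈ Subgroup.center G := Subgroup.mem_center_iff.2 fun g => (h.commute g).eq.symm
  -- Both sides are central and have the same length.
  have hpow : x ^ (N * len z) = j z ^ (ℓ (x ^ N)).toAdd := by
    have hmem : x ^ (N * len z) * (j z ^ (ℓ (x ^ N)).toAdd)⁻¹ ∈ Subgroup.center G := by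
      rw [pow_mul]
      exact mul_mem (pow_mem hx _) (inv_mem (zpow_mem hzc _))
    refine mul_inv_eq_one.1 (h.eq_one_of_length_eq_one
      (fun g => (Subgroup.mem_center_iff.1 hmem g).symm) ?_)
    rw [map_mul, map_inv, map_zpow, h.length_map, pow_mul, map_pow, mul_inv_eq_one]
    refine Multiplicative.toAdd.injective ?_
    rw [toAdd_pow, toAdd_zpow, toAdd_ofAdd, nsmul_eq_mul, smul_eq_mul, mul_comm]
  obtain ⟨v, r, ⟨a, ha⟩, b, hb⟩ := exists_conj_mem_of_pow_eq h.exists_join ⟨z, rfl⟩ h.commute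
    (Nat.mul_pos hN hz0) hpow
  refine ⟨v, a, j z ^ r, zpow_mem hzc r, ?_, ?_⟩
  · rw [← ha, eq_mul_inv_iff_mul_eq, ← map_mul] at hb
    rw [← h.injective hb, len_mul]
    omega
  · rw [ha, zpow_neg, mul_inv_cancel_left]

end IsFractionGroup

end Fractions

/-! ### The fundamental element of type `D` -/

section FundamentalElement

variable {M : Type*} [Monoid M]

/-- The palindromes `c (k-1) ⋯ c 0 a b c 0 ⋯ c (k-1)`. -/
def palindrome (a b : M) (c : ℕ → M) : ℕ → M
  | 0 => a * b
  | k + 1 => c k * palindrome a b c k * c k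

/-- The product of the first `k` palindromes. -/
def palindromeProd (a b : M) (c : ℕ → M) : ℕ → M
  | 0 => 1
  | k + 1 => palindromeProd a b c k * palindrome a b c k

/-- The elements `a`, `b`, `c 0`, …, `c (m-1)` satisfy the braid relations of type `D`: the path
`c (m-1), …, c 0, a` together with an edge from `c 0` to `b`. -/
structure IsTypeD (a b : M) (c : ℕ → M) (m : ℕ) : Prop where
  comm_ab : Commute a b
  comm_a : ∀ i, i < m → 0 < i → Commute a (c i)
  comm_b : ∀ i, i < m → 0 < i → Commute b (c i)
  braid_a : 0 < m → a * c 0 * a = c 0 * a * c 0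
  braid_b : 0 < m → b * c 0 * b = c 0 * b * c 0
  comm_c : ∀ i j, i + 1 < j → j < m → Commute (c i) (c j)
  braid_c : ∀ i, i + 1 < m → c i * c (i + 1) * c i = c (i + 1) * c i * c (i + 1)

namespace IsTypeD

variable {a b : M} {c : ℕ → M} {m : ℕ}

lemma commute_palindrome_of_lt (h : IsTypeD a b c m) {i j : ℕ} (hij : j < i) (hi : i < m) :
    Commute (c i) (palindrome a b c j) := by
  induction j with
  | zero => exact ((h.comm_a i hi hij).symm).mul_right (h.comm_b i hi hij).symm
  | succ j ih =>
    have := (h.comm_c j i hij hi).symm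
    exact (this.mul_right (ih (by omega))).mul_right this

/-- Passing through the innermost `c 0 * (a * b) * c 0` swaps `a` and `b`; the outer letters commute
with both. -/
lemma palindrome_mul (h : IsTypeD a b c m) {j : ℕ} (hj : j + 1 ≤ m) :
    a * palindrome a b c (j + 1) = palindrome a b c (j + 1) * b ∧
      b * palindrome a b c (j + 1) = palindrome a b c (j + 1) * a := by
  induction j with
  | zero =>
    have ha := h.braid_a hj
    have hb := h.braid_b hj
    have hab := h.comm_ab.eq
    simp only [palindrome]
    constructor
    · calc a * (c 0 * (a * b) * c 0) = (a * c 0 * a) * (b * c 0) := by simp only [mul_assoc]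
        _ = c 0 * a * (c 0 * b * c 0) := by rw [ha]; simp only [mul_assoc]
        _ = c 0 * (a * b) * c 0 * b := by rw [← hb]; simp only [mul_assoc]
    · calc b * (c 0 * (a * b) * c 0) = (b * c 0 * b) * (a * c 0) := by
            rw [hab]; simp only [mul_assoc]
        _ = c 0 * b * (c 0 * a * c 0) := by rw [hb]; simp only [mul_assoc]
        _ = c 0 * (b * a) * c 0 * a := by rw [← ha]; simp only [mul_assoc]
        _ = c 0 * (a * b) * c 0 * a := by rw [hab]
  | succ j ih =>
    obtain ⟨h1, h2⟩ := ih (by omega)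
    have ha := (h.comm_a (j + 1) (by omega) (by omega)).eq
    have hb := (h.comm_b (j + 1) (by omega) (by omega)).eq
    rw [palindrome]
    constructor
    · rw [← mul_assoc, ← mul_assoc, ha, mul_assoc (c _) a, h1, mul_assoc, mul_assoc, mul_assoc, hb]
      simp only [mul_assoc]
    · rw [← mul_assoc, ← mul_assoc, hb, mul_assoc (c _) b, h2, mul_assoc, mul_assoc, mul_assoc, ha]
      simp only [mul_assoc]

lemma commute_palindrome_of_gt (h : IsTypeD a b c m) {i j : ℕ} (hij : i + 1 < j) (hj : j ≤ m) :
    Commute (c i) (palindrome a b c j) := by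
  obtain ⟨k, rfl⟩ : ∃ k, j = i + 2 + k := ⟨j - (i + 2), by omega⟩
  clear hij
  induction k with
  | zero =>
    have e := (h.commute_palindrome_of_lt (Nat.lt_succ_self i) (by omega : i + 1 < m)).eq
    have hb := h.braid_c i (by omega)
    change c i * (c (i + 1) * (c i * palindrome a b c i * c i) * c (i + 1)) =
      c (i + 1) * (c i * palindrome a b c i * c i) * c (i + 1) * c i
    calc _ = (c i * c (i + 1) * c i) * palindrome a b c i * (c i * c (i + 1)) := by
          simp only [mul_assoc]
      _ = c (i + 1) * c i * (c (i + 1) * palindrome a b c i) * (c i * c (i + 1)) := by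
          rw [hb]; simp only [mul_assoc]
      _ = c (i + 1) * c i * palindrome a b c i * (c (i + 1) * c i * c (i + 1)) := by
          rw [e]; simp only [mul_assoc]
      _ = _ := by rw [← hb]; simp only [mul_assoc]
  | succ k ih =>
    have := h.comm_c i (i + 2 + k) (by omega) (by omega)
    exact (this.mul_right (ih (by omega))).mul_right this

lemma commute_palindrome (h : IsTypeD a b c m) {i j : ℕ} (hij : i < j) (hj : j ≤ m) :
    Commute (palindrome a b c i) (palindrome a b c j) := by
  induction i with
  | zero =>
    obtain ⟨j, rfl⟩ : ∃ k, j = k + 1 := ⟨j - 1, by omega⟩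
    obtain ⟨h1, h2⟩ := h.palindrome_mul hj
    change a * b * palindrome a b c (j + 1) = palindrome a b c (j + 1) * (a * b)
    rw [mul_assoc, h2, ← mul_assoc, h1, mul_assoc, h.comm_ab.eq]
  | succ i ih =>
    have := h.commute_palindrome_of_gt hij hj
    exact (this.mul_left (ih (by omega))).mul_left this

/-- The palindromes `i` and `i + 1` need not commute with `c i` separately, but their product does.
The excluded `k` is the one that separates them. -/
lemma commute_palindromeProd (h : IsTypeD a b c m) {i k : ℕ} (hik : i < m)
    (hk : k ≤ m + 1) (hne : k ≠ i + 1) : Commute (c i) (palindromeProd a b c k) := by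
  induction k using Nat.strong_induction_on with | _ k ih
  obtain _ | k := k
  · exact Commute.one_right _
  obtain hlt | rfl | hgt : k < i ∨ k = i + 1 ∨ i + 1 < k := by omega
  · exact (ih k (by omega) (by omega) (by omega)).mul_right (h.commute_palindrome_of_lt hlt hik)
  · have h1 := ih i (by omega) (by omega) (by omega)
    have e := (h.commute_palindrome (Nat.lt_succ_self i) (by omega : i + 1 ≤ m)).eq
    change Commute (c i) (palindromeProd a b c i * palindrome a b c i * palindrome a b c (i + 1))
    rw [mul_assoc]
    refine h1.mul_right ?_
    change c i * (palindrome a b c i * palindrome a b c (i + 1)) =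
      palindrome a b c i * palindrome a b c (i + 1) * c i
    calc c i * (palindrome a b c i * palindrome a b c (i + 1))
        = palindrome a b c (i + 1) * palindrome a b c i * c i := by
          simp only [palindrome, mul_assoc]
      _ = _ := by rw [e]
  · exact (ih k (by omega) (by omega) (by omega)).mul_right
      (h.commute_palindrome_of_gt hgt (by omega))

/-- Every palindrome but the first swaps `a` and `b`, so parity decides; this is why the central
element is a square. -/
lemma palindromeProd_mul (h : IsTypeD a b c m) {k : ℕ} (hk : k ≤ m + 1) :
    (Commute a (palindromeProd a b c k) ∧ Commute b (palindromeProd a b c k)) ∨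
      (a * palindromeProd a b c k = palindromeProd a b c k * b ∧
        b * palindromeProd a b c k = palindromeProd a b c k * a) := by
  induction k with
  | zero => exact .inl ⟨Commute.one_right _, Commute.one_right _⟩
  | succ k ih =>
    obtain _ | k := k
    · left
      simp only [palindromeProd, palindrome, one_mul]
      exact ⟨(Commute.refl a).mul_right h.comm_ab, h.comm_ab.symm.mul_right (Commute.refl b)⟩
    obtain ⟨h1, h2⟩ := h.palindrome_mul (j := k) (by omega)
    rw [palindromeProd]
    obtain ⟨h3, h4⟩ | ⟨h3, h4⟩ := ih (by omega)
    · right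
      exact ⟨by rw [← mul_assoc, h3.eq, mul_assoc, h1, mul_assoc],
        by rw [← mul_assoc, h4.eq, mul_assoc, h2, mul_assoc]⟩
    · left
      rw [Commute, Commute, SemiconjBy, SemiconjBy]
      exact ⟨by rw [← mul_assoc, h3, mul_assoc, h2, mul_assoc],
        by rw [← mul_assoc, h4, mul_assoc, h1, mul_assoc]⟩

/-- The square of the fundamental element commutes with all the generators. -/
theorem commute_sq (h : IsTypeD a b c m) :
    Commute a (palindromeProd a b c (m + 1) ^ 2) ∧ Commute b (palindromeProd a b c (m + 1) ^ 2) ∧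
      ∀ i, i < m → Commute (c i) (palindromeProd a b c (m + 1) ^ 2) := by
  rw [← and_assoc]
  refine ⟨?_, fun i hi => (h.commute_palindromeProd hi le_rfl (by omega)).pow_right 2⟩
  obtain ⟨h1, h2⟩ | ⟨h1, h2⟩ := h.palindromeProd_mul le_rfl
  · exact ⟨h1.pow_right 2, h2.pow_right 2⟩
  · rw [Commute, Commute, SemiconjBy, SemiconjBy, sq]
    exact ⟨by rw [← mul_assoc, h1, mul_assoc, h2, mul_assoc],
      by rw [← mul_assoc, h2, mul_assoc, h1, mul_assoc]⟩

end IsTypeD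

lemma dvd_palindromeProd (a b : M) (c : ℕ → M) (k : ℕ) : a ∣ palindromeProd a b c (k + 1) := by
  induction k with
  | zero => exact ⟨b, by simp [palindromeProd, palindrome]⟩
  | succ k ih => exact ih.trans (dvd_mul_right _ _)

end FundamentalElement

/-! ### The Artin group of type `D` -/

section TypeD

open BraidMonoid

/-- The Coxeter graph of type `D`. -/
def dGraph (n : ℕ) : SimpleGraph (Fin n) where
  Adj := dAdj n
  symm := ⟨fun i j h => by unfold dAdj at *; tauto⟩
  loopless := ⟨fun i h => by unfold dAdj at h; omega⟩

lemma dGraph_triangleFree (n : ℕ) (a b c : Fin n) (hab : (dGraph n).Adj a b)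
    (hbc : (dGraph n).Adj b c) : ¬ (dGraph n).Adj a c := by
  simp only [dGraph, dAdj] at *
  omega

lemma dGraph_preconnected (n : ℕ) (hn : 3 ≤ n) : (dGraph n).Preconnected := by
  have key : ∀ k (hk : k < n), (dGraph n).Reachable ⟨0, by omega⟩ ⟨k, hk⟩ := by
    intro k
    induction k using Nat.strong_induction_on with | _ k ih
    intro hk
    obtain _ | k := k
    · exact .rfl
    -- The last vertex hangs on `n - 3`, two steps back, and not on its predecessor.
    obtain h1 | h1 : k + 2 < n ∨ k + 2 = n := by omega
    · refine (ih k (by omega) (by omega)).trans (SimpleGraph.Adj.reachable ?_)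
      exact .inl ⟨rfl, h1⟩
    · refine (ih (k - 1) (by omega) (by omega)).trans (SimpleGraph.Adj.reachable ?_)
      exact .inr (.inr (.inl ⟨show k - 1 + 2 = k + 1 by omega, h1⟩))
  exact fun i j => (key i i.2).symm.trans (key j j.2)

/-- The Artin monoid of type `D` has a nontrivial central element. -/
lemma exists_central_dGraph (n : ℕ) (hn : 3 ≤ n) :
    ∃ z : BraidMonoid (dGraph n), (∀ x, z * x = x * z) ∧ z ≠ 1 := by
  -- The leaves at the fork are `a` and `b`; `c` walks from the branch vertex `n - 3` down to `0`.
  -- Indices from `n - 2` on are truncated and never used.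
  set a : BraidMonoid (dGraph n) := gen ⟨n - 1, by omega⟩
  set b : BraidMonoid (dGraph n) := gen ⟨n - 2, by omega⟩
  set c : ℕ → BraidMonoid (dGraph n) := fun i => gen ⟨n - 3 - i, by omega⟩
  have h : IsTypeD a b c (n - 2) :=
    { comm_ab := gen_comm (by simp only [dGraph, dAdj]; omega)
      comm_a := fun i hi hi0 => gen_comm (by simp only [dGraph, dAdj]; omega)
      comm_b := fun i hi hi0 => gen_comm (by simp only [dGraph, dAdj]; omega)
      braid_a := fun h => gen_braid (by simp only [dGraph, dAdj]; omega)
      braid_b := fun h => gen_braid (by simp only [dGraph, dAdj]; omega)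
      comm_c := fun i j hij hj => gen_comm (by simp only [dGraph, dAdj]; omega)
      braid_c := fun i hi => gen_braid (by simp only [dGraph, dAdj]; omega) }
  obtain ⟨ha, hb, hc⟩ := h.commute_sq
  refine ⟨palindromeProd a b c (n - 2 + 1) ^ 2, fun x => ?_, fun h1 => ?_⟩
  · suffices Commute x (palindromeProd a b c (n - 2 + 1) ^ 2) from this.eq.symm
    induction x using gen_induction with
    | one => exact Commute.one_left _
    | mul s y ih =>
      refine Commute.mul_left ?_ ih
      obtain ⟨s, hs⟩ := s
      obtain rfl | rfl | hlt : s = n - 1 ∨ s = n - 2 ∨ s < n - 2 := by omega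
      · exact ha
      · exact hb
      · have := hc (n - 3 - s) (by omega)
        have e : n - 3 - (n - 3 - s) = s := by omega
        simp only [c, e] at this
        exact this
  · obtain ⟨y, hy⟩ := dvd_palindromeProd a b c (n - 2)
    have := congrArg len h1
    rw [hy, sq] at this
    simp [a] at this

end TypeD

/-! ### The Artin group of type D as a group of fractions -/

section ArtinD

open BraidMonoid

lemma map_altProd {G H : Type*} [Monoid G] [Monoid H] (f : G →* H) (a b : G) (m : ℕ) :
    f (altProd a b m) = altProd (f a) (f b) m := by
  induction m generalizing a b with
  | zero => exact map_one f
  | succ m ih => rw [altProd, altProd, map_mul, ih]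

lemma coxeterMatrixD_of_adj {n : ℕ} {i j : Fin n} (h : (dGraph n).Adj i j) :
    coxeterMatrixD n i j = 3 := by
  have hne := h.ne
  change (if i = j then 1 else if dAdj n i j then 3 else 2) = 3
  rw [if_neg hne]
  exact if_pos h

lemma coxeterMatrixD_of_not_adj {n : ℕ} {i j : Fin n} (hne : i ≠ j) (h : ¬ (dGraph n).Adj i j) :
    coxeterMatrixD n i j = 2 := by
  change (if i = j then 1 else if dAdj n i j then 3 else 2) = 2
  rw [if_neg hne]
  exact if_neg h

lemma altProd_of_eq_altProd_of {n : ℕ} {i j : Fin n} (hne : i ≠ j)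
    (h0 : coxeterMatrixD n i j ≠ 0) :
    altProd (PresentedGroup.of i : ArtinGroup (coxeterMatrixD n)) (PresentedGroup.of j)
        (coxeterMatrixD n i j) =
      altProd (PresentedGroup.of j) (PresentedGroup.of i) (coxeterMatrixD n i j) := by
  have h := PresentedGroup.mk_eq_mk_of_mul_inv_mem (rels := artinRels (coxeterMatrixD n))
    ⟨i, j, hne, h0, rfl⟩
  rw [map_altProd, map_altProd] at h
  exact h

/-- The homomorphism from the Artin monoid of type `D` to the Artin group of type `D`. -/
def toArtinGroup (n : ℕ) : BraidMonoid (dGraph n) →* ArtinGroup (coxeterMatrixD n) :=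
  BraidMonoid.lift (fun i => PresentedGroup.of i)
    (fun i j h => by
      by_cases hne : i = j
      · rw [hne]
      have := altProd_of_eq_altProd_of hne (by rw [coxeterMatrixD_of_not_adj hne h]; decide)
      simpa [coxeterMatrixD_of_not_adj hne h, altProd] using this)
    (fun i j h => by
      have := altProd_of_eq_altProd_of h.ne (by rw [coxeterMatrixD_of_adj h]; decide)
      simpa [coxeterMatrixD_of_adj h, altProd, mul_assoc] using this)

/-- A map of the generators satisfying the relations extends to the Artin group of type `D`. -/
lemma exists_artinGroup_hom {n : ℕ} {G : Type*} [Group G] (j : BraidMonoid (dGraph n) →* G) :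
    ∃ f : ArtinGroup (coxeterMatrixD n) →* G, f.comp (toArtinGroup n) = j := by
  refine ⟨PresentedGroup.toGroup (f := fun i => j (gen i)) ?_, hom_ext fun s => ?_⟩
  · rintro _ ⟨s, t, hne, -, rfl⟩
    rw [map_mul, map_inv, mul_inv_eq_one, map_altProd, map_altProd, FreeGroup.lift_apply_of,
      FreeGroup.lift_apply_of]
    by_cases h : (dGraph n).Adj s t
    · simp only [coxeterMatrixD_of_adj h, altProd, mul_one, ← map_mul, ← mul_assoc, gen_braid h]
    · simp only [coxeterMatrixD_of_not_adj hne h, altProd, mul_one, ← map_mul, gen_comm h]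
  · exact FreeGroup.lift_apply_of

/-- The monoid embeds in some group, and that embedding factors through the Artin group. Inverses of
generators are absorbed by `z`, which they divide. -/
lemma exists_isFractionGroup (n : ℕ) (hn : 3 ≤ n) : ∃ z ℓ,
    IsFractionGroup (Γ := dGraph n) z (toArtinGroup n) ℓ := by
  obtain ⟨z, hz, hz1⟩ := exists_central_dGraph n hn
  have hg : ∀ s, gen s ∣ z := IsQuasiCentral.gen_dvd (dGraph_triangleFree n)
    (dGraph_preconnected n hn) (fun s => ⟨s, (hz _).symm⟩) hz1
  obtain ⟨U, _, j, hj⟩ := exists_injective_hom_group (dGraph_triangleFree n) hz hg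
  obtain ⟨f, hf⟩ := exists_artinGroup_hom j
  obtain ⟨ℓ, hℓ⟩ := exists_artinGroup_hom (n := n) (BraidMonoid.lift
    (fun _ => Multiplicative.ofAdd (1 : ℤ)) (fun _ _ _ => rfl) (fun _ _ _ => rfl))
  refine ⟨z, ℓ, dGraph_triangleFree n, dGraph_preconnected n hn, hz, hz1, ?_, ?_, ?_⟩
  · exact Function.Injective.of_comp (f := f) (by rw [← MonoidHom.coe_comp, hf]; exact hj)
  · intro g
    have hgen : g ∈ Subgroup.closure
        (Set.range (PresentedGroup.of (rels := artinRels (coxeterMatrixD n)))) := by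
      rw [PresentedGroup.closure_range_of]; trivial
    induction hgen using Subgroup.closure_induction_left with
    | one => exact ⟨0, 1, by simp⟩
    | mul_left x hx y _ ih =>
      obtain ⟨s, rfl⟩ := hx
      obtain ⟨k, a, ha⟩ := ih
      exact ⟨k, gen s * a, by rw [map_mul, mul_assoc, ha]; rfl⟩
    | inv_mul_cancel x hx y _ ih =>
      obtain ⟨s, rfl⟩ := hx
      obtain ⟨k, a, ha⟩ := ih
      obtain ⟨c, hc'⟩ := hg s
      refine ⟨k + 1, c * a, ?_⟩
      rw [mul_assoc, inv_mul_eq_iff_eq_mul, pow_succ, ← mul_assoc, ha, ← map_mul, ← hz,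
        hc', mul_assoc, map_mul _ (gen s)]
      rfl
  · intro s
    exact DFunLike.congr_fun hℓ (gen s)

lemma BraidMonoid.hom_eq_pow_len {S : Type*} {Γ : SimpleGraph S} {N : Type*} [Monoid N]
    (f : BraidMonoid Γ →* N) {g : N} (hf : ∀ s, f (gen s) = g) (x : BraidMonoid Γ) :
    f x = g ^ len x := by
  induction x using gen_induction with
  | one => simp
  | mul s y ih => rw [map_mul, ih, hf, len_mul, len_gen, pow_add, pow_one]

/-- A homomorphism with commutative image takes the same value on all the generators. -/
lemma BraidMonoid.hom_gen_eq {S : Type*} {Γ : SimpleGraph S} {G : Type*} [Group G]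
    (hconn : Γ.Preconnected) (f : BraidMonoid Γ →* G) (hf : ∀ x y, Commute (f x) (f y)) (s t : S) :
    f (gen s) = f (gen t) := by
  obtain ⟨p⟩ := hconn s t
  induction p with
  | nil => rfl
  | @cons u v w hadj _ ih =>
    refine Eq.trans ?_ ih
    have := congrArg f (gen_braid hadj)
    simp only [map_mul] at this
    rw [(hf (gen u) (gen v)).eq, mul_right_inj] at this
    exact this

end ArtinD

theorem propositionA7 (n : ℕ) (hn : 4 ≤ n) :
    {c : Quotient (homConj (ArtinDModCenter n) (ArtinDModCenter n)) |
      ∃ φ : ArtinDModCenter n →* ArtinDModCenter n, IsCyclicHom φ ∧ c = Quotient.mk _ φ}.Finite := by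
  obtain ⟨z, ℓ, h⟩ := exists_isFractionGroup n (by omega)
  set π : BraidMonoid (dGraph n) →* ArtinDModCenter n :=
    (QuotientGroup.mk' _).comp (toArtinGroup n)
  have hext : ∀ φ ψ : ArtinDModCenter n →* ArtinDModCenter n,
      (∀ s, φ (π (BraidMonoid.gen s)) = ψ (π (BraidMonoid.gen s))) → φ = ψ := by
    intro φ ψ hφψ
    refine QuotientGroup.monoidHom_ext _ (PresentedGroup.ext fun s => hφψ s)
  -- Each short positive `a` accounts for at most one endomorphism with constant value `π a` on the
  -- generators.
  refine ((BraidMonoid.finite_len_le (Γ := dGraph n) (BraidMonoid.len z)).biUnion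
    (t := fun a => {c | ∃ φ : ArtinDModCenter n →* ArtinDModCenter n,
      (∀ s, φ (π (BraidMonoid.gen s)) = π a) ∧ c = Quotient.mk _ φ}) ?_).subset ?_
  · intro a _
    refine Set.Subsingleton.finite ?_
    rintro _ ⟨φ, hφ, rfl⟩ _ ⟨ψ, hψ, rfl⟩
    rw [hext φ ψ fun s => by rw [hφ, hψ]]
  · rintro _ ⟨φ, hφ, rfl⟩
    have hcomm : ∀ x y, Commute (φ x) (φ y) := by
      intro x y
      have : IsCyclic φ.range := hφ
      let _ : CommGroup φ.range := IsCyclic.commGroup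
      exact congrArg Subtype.val (mul_comm (⟨φ x, x, rfl⟩ : φ.range) ⟨φ y, y, rfl⟩)
    obtain ⟨x, hx⟩ := QuotientGroup.mk'_surjective _
      (φ (π (BraidMonoid.gen ⟨0, by omega⟩)))
    have hgen : ∀ s, φ (π (BraidMonoid.gen s)) = QuotientGroup.mk' _ x := fun s => by
      rw [hx]
      exact BraidMonoid.hom_gen_eq h.preconnected (φ.comp π) (fun x y => hcomm _ _) _ _
    have hpow : x ^ BraidMonoid.len z ∈ Subgroup.center _ := by
      rw [← QuotientGroup.eq_one_iff]
      -- The image of `z` is computed twice: as a power of the common value, and as `1` because `z`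
      -- is central.
      have h1 := BraidMonoid.hom_eq_pow_len (φ.comp π) hgen z
      have h2 : π z = 1 := (QuotientGroup.eq_one_iff _).2
        (Subgroup.mem_center_iff.2 fun g => (h.commute g).eq.symm)
      rw [MonoidHom.comp_apply, h2, map_one] at h1
      exact h1.symm
    obtain ⟨v, a, ζ, hζ, ha, hv⟩ := h.exists_conj_of_pow_central
      (Nat.pos_of_ne_zero fun h0 => h.ne_one (BraidMonoid.eq_one_of_len_eq_zero h0)) hpow
    refine Set.mem_biUnion (x := a) ha
      ⟨(MulAut.conj (QuotientGroup.mk' _ v⁻¹)).toMonoidHom.comp φ, fun s => ?_,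
        Quotient.sound ⟨_, rfl⟩⟩
    have hv' := congrArg (QuotientGroup.mk' (Subgroup.center _)) hv
    rw [map_mul _ ζ, show QuotientGroup.mk' (Subgroup.center _) ζ = 1 from
      (QuotientGroup.eq_one_iff _).2 hζ, one_mul] at hv'
    rw [MonoidHom.comp_apply, hgen]
    refine Eq.trans ?_ hv'
    simp
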